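/- Let $G$ be a finite simple graph. An $S^1$-embedding of $G$ is an injective map $f$ from the vertex set of $G$ to the circle $S^1$. Two disjoint pairs $\{p_1,p_2\}$, $\{p_3,p_4\}$ of points of $S^1$ (all four points distinct) form a non-splittable link if $p_3$ and $p_4$ lie in different connected components of $S^1\setminus\{p_1,p_2\}$. The graph $G$ is intrinsically $S^1$-linked if for every $S^1$-embedding $f$ of $G$ there are two disjoint edges $ab$ and $cd$ of $G$ such that $\{f(a),f(b)\}$ and $\{f(c),f(d)\}$ form a non-splittable link. The graph $G$ is outerplanar if it can be embedded in the plane (vertices as distinct points, edges as arcs joining their endpoints, arcs meeting each other and the vertices only in common endpoints) so that every vertex lies on the boundary of the outer face, i.e. of the unbounded connected component of the complement of the embedded graph. **Theorem.** A finite simple graph is intrinsically $S^1$-linked if and only if it is not outerplanar. -/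

import Mathlib

/-- The pairs of points `{p₁, p₂}` and `{p₃, p₄}` of the circle form a non-splittable link: the four
points are distinct (so that the pairs are two disjoint embedded copies of `S⁰`), and `p₃`, `p₄` lie
in different connected components of the circle minus `{p₁, p₂}`. -/
def NonSplittableLink (p₁ p₂ p₃ p₄ : Circle) : Prop :=
  [p₁, p₂, p₃, p₄].Nodup ∧
    connectedComponentIn ({p₁, p₂}ᶜ : Set Circle) p₃ ≠
      connectedComponentIn ({p₁, p₂}ᶜ : Set Circle) p₄

/-- Every injective map of the vertices into the circle has two disjoint edges `ab`, `cd` whose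
endpoint pairs are mapped to a non-splittable link. -/
def IsIntrinsicallyCircleLinked {V : Type*} (G : SimpleGraph V) : Prop :=
  ∀ f : V → Circle, Function.Injective f →
    ∃ a b c d : V, G.Adj a b ∧ G.Adj c d ∧ Disjoint ({a, b} : Set V) {c, d} ∧
      NonSplittableLink (f a) (f b) (f c) (f d)

/-- `A` is an arc in the plane with the endpoints `x` and `y`: the image of an injective continuous
path from `x` to `y`. The plane is `ℂ`. -/
def IsPlaneArc (A : Set ℂ) (x y : ℂ) : Prop :=
  ∃ γ : Path x y, Function.Injective γ ∧ Set.range γ = A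

/-- An embedding of a graph in the plane: vertices are distinct points, each edge is an arc between
its endpoints, an arc passes through no vertex other than its endpoints, and the arcs of two
different edges meet only in common endpoints. -/
structure PlaneEmbedding {V : Type*} (G : SimpleGraph V) where
  point : V → ℂ
  arc : G.edgeSet → Set ℂ
  point_injective : Function.Injective point
  isPlaneArc : ∀ (a b : V) (h : G.Adj a b), IsPlaneArc (arc ⟨s(a, b), h⟩) (point a) (point b)
  mem_of_point_mem_arc : ∀ (e : G.edgeSet) (v : V), point v ∈ arc e → v ∈ (e : Sym2 V)
  arc_inter_arc : ∀ e e' : G.edgeSet, e ≠ e' →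
    arc e ∩ arc e' ⊆ point '' {v | v ∈ (e : Sym2 V) ∧ v ∈ (e' : Sym2 V)}

/-- The subset of the plane occupied by the embedded graph. -/
def PlaneEmbedding.support {V : Type*} {G : SimpleGraph V} (D : PlaneEmbedding G) : Set ℂ :=
  Set.range D.point ∪ ⋃ e, D.arc e

/-- The outer face: the points off the graph whose connected component in the complement of the
graph is unbounded. (For a finite graph the complement of the compact set `D.support` has exactly
one unbounded component, and this is it.) -/
def PlaneEmbedding.outerFace {V : Type*} {G : SimpleGraph V} (D : PlaneEmbedding G) : Set ℂ :=
  {z | z ∈ D.supportᶜ ∧ ¬ Bornology.IsBounded (connectedComponentIn D.supportᶜ z)}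

/-- A graph is outerplanar if it has an embedding in the plane for which every vertex touches the
outer face, i.e. lies on its boundary. -/
def IsOuterplanar {V : Type*} (G : SimpleGraph V) : Prop :=
  ∃ D : PlaneEmbedding G, ∀ v : V, D.point v ∈ frontier D.outerFace

/-!
Both directions pass through a combinatorial notion: a cyclic order of the vertices in which no two
edges cross.

If a circle embedding has no link, the edges can be drawn as straight chords. Chords that form no
link are disjoint, and the drawing stays in the closed unit disc, so every vertex touches the outer
face (`isOuterplanar_of_forall_not_nonSplittableLink`).

Conversely, let `G` be embedded in the plane with every vertex on the boundary of the outer face. A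
point of the outer face can be joined to each vertex by a path that meets only the arcs at that
vertex (`PlaneEmbedding.exists_joinedIn_compl_trace`). Hence a subdivided `K₂,₃` or `K₄` in `G`
would give a drawing of `K₃,₃` or `K₅` in the plane whose independent edges are disjoint. That is
impossible by a parity count (`not_exists_drawing_K33`, `not_exists_drawing_K5`), which needs no
form of the Jordan curve theorem: for two disjoint paths `α` and `β` the function `β t - α s` has a
continuous logarithm on the square, so its variations along the four sides cancel
(`exists_deviation_relation`). Summed over all pairs of independent edges, each variation cancels
modulo two, while the contributions of the end points add up to an odd number.

A finite graph without these two configurations has a noncrossing order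
(`SimpleGraph.exists_nonCrossing`), by induction on the vertex set. At a cut vertex the orders of the
two sides are glued. If there is none, a longest closed walk without repetitions misses no vertex,
because an ear would make it longer or produce a subdivided `K₂,₃`; and two of its chords cannot
cross, because they would form a subdivided `K₄` with it. Placing the vertices on the circle in a
noncrossing order gives an embedding without links
(`SimpleGraph.NonCrossing.not_isIntrinsicallyCircleLinked`).
-/

/-! ### A parity obstruction to drawing a graph in the plane -/

open Complex in
/-- A nowhere vanishing continuous function on a simply connected space has a continuous
logarithm. -/
theorem exists_continuous_log {X : Type*} [TopologicalSpace X] [SimplyConnectedSpace X]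
    [LocallyPathConnectedSpace X] {g : X → ℂ} (hg : Continuous g) (h0 : ∀ x, g x ≠ 0) :
    ∃ F : X → ℂ, Continuous F ∧ ∀ x, exp (F x) = g x := by
  obtain ⟨x₀⟩ : Nonempty X := inferInstance
  obtain ⟨F, ⟨-, hF⟩, -⟩ := isCoveringMapOn_exp.existsUnique_continuousMap_lifts
    (⟨g, hg⟩ : C(X, ℂ)) (a₀ := x₀) (e₀ := log (g x₀)) (exp_log (h0 x₀)) (fun x => h0 x)
  exact ⟨F, F.continuous, fun x => congrFun hF x⟩

open Complex in
/-- The variation of a continuous logarithm along the line depends only on its exponential. -/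
theorem sub_eq_sub_of_exp_eq {F F' : ℝ → ℂ} (hF : Continuous F) (hF' : Continuous F')
    (h : ∀ t, exp (F t) = exp (F' t)) (s t : ℝ) : F t - F s = F' t - F' s := by
  obtain ⟨n, hn⟩ := exp_eq_exp_iff_exists_int.1 (h s)
  have key := isCoveringMap_exp.eq_of_comp_eq hF
    (hF'.add (continuous_const (y := (n : ℂ) * (2 * Real.pi * I)))) (by
      funext u
      apply Subtype.ext
      have := exp_periodic.int_mul n (F' u)
      simp only [Function.comp_apply, h u]
      exact this.symm) s hn
  have ht := congrFun key t
  rw [ht, hn, Pi.add_apply]; ring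

open Complex in
/-- `k` is the deviation, in full turns, between the variation of a continuous logarithm of `γ - v`
along the path `γ` and the difference `log (d - v) - log (c - v)` of principal logarithms. There is
no such continuous logarithm, and hence no condition on `k`, when `γ` passes through `v`. -/
def IsWindingDeviation (v : ℂ) {c d : ℂ} (γ : Path c d) (k : ℤ) : Prop :=
  ∀ F : ℝ → ℂ, Continuous F → (∀ t, exp (F t) = γ.extend t - v) →
    F 1 - F 0 = log (d - v) - log (c - v) + k * (2 * Real.pi * I)

open Complex in
theorem exists_isWindingDeviation (v : ℂ) {c d : ℂ} (γ : Path c d) :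
    ∃ k : ℤ, IsWindingDeviation v γ k := by
  by_cases hF : ∃ F : ℝ → ℂ, Continuous F ∧ ∀ t, exp (F t) = γ.extend t - v
  · obtain ⟨F, hc, hF⟩ := hF
    have h0 : exp (F 0) = c - v := by simpa using hF 0
    have h1 : exp (F 1) = d - v := by simpa using hF 1
    have h0' : exp (F 0) = exp (log (c - v)) := by
      rw [exp_log (h0 ▸ exp_ne_zero _), h0]
    have h1' : exp (F 1) = exp (log (d - v)) := by
      rw [exp_log (h1 ▸ exp_ne_zero _), h1]
    obtain ⟨m, hm⟩ := exp_eq_exp_iff_exists_int.1 h0'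
    obtain ⟨n, hn⟩ := exp_eq_exp_iff_exists_int.1 h1'
    refine ⟨n - m, fun F' hc' hF' => ?_⟩
    rw [sub_eq_sub_of_exp_eq hc' hc (fun t => (hF' t).trans (hF t).symm) 0 1, hm, hn]
    push_cast; ring
  · exact ⟨0, fun F hc h => (hF ⟨F, hc, h⟩).elim⟩

open Complex in
/-- The principal logarithms of `w` and `-w` differ by an odd multiple of `π i`. -/
theorem exists_log_neg_sub_log {w : ℂ} (hw : w ≠ 0) :
    ∃ k : ℤ, log (-w) - log w = Real.pi * I * (2 * k - 1) := by
  have h : exp (log (-w)) = exp (log w - Real.pi * I) := by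
    rw [exp_log (neg_ne_zero.2 hw), exp_sub, exp_log hw, exp_pi_mul_I, div_neg, div_one]
  obtain ⟨k, hk⟩ := exp_eq_exp_iff_exists_int.1 h
  exact ⟨k, by rw [hk]; ring⟩

open Complex in
/-- Two disjoint paths `α`, `β` give a nowhere zero function `β t - α s` on the square. It has a
continuous logarithm there, so its variations along the four sides add up to zero; this is the
stated relation, counted in full turns. The integers `m` measure the variation along one side,
and `τ` records the change of branch between `x - y` and `y - x`. -/
theorem exists_deviation_relation : ∃ (τ : ℂ → ℂ → ℤ) (m : ∀ {c d : ℂ}, ℂ → Path c d → ℤ),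
    (∀ x y, x ≠ y → τ x y + τ y x = 1) ∧
    ∀ {a b c d : ℂ} (α : Path a b) (β : Path c d), Disjoint (Set.range α) (Set.range β) →
      m a β - m b β - m c α + m d α = τ a c - τ a d + τ b d - τ b c := by
  have hτ : ∀ x y : ℂ, ∃ k : ℤ, x ≠ y → log (y - x) - log (x - y) = Real.pi * I * (2 * k - 1) := by
    intro x y
    by_cases h : x = y
    · exact ⟨0, fun h' => (h' h).elim⟩
    · obtain ⟨k, hk⟩ := exists_log_neg_sub_log (sub_ne_zero.2 h)
      exact ⟨k, fun _ => by rw [← hk, neg_sub]⟩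
  choose τ hτ using hτ
  choose m hm using @exists_isWindingDeviation
  have hpi : (Real.pi * I : ℂ) ≠ 0 := by simp [Real.pi_ne_zero]
  refine ⟨τ, fun {_ _} v γ => m v γ, fun x y hxy => ?_, fun {a b c d} α β hdisj => ?_⟩
  · have h1 := hτ x y hxy
    have h2 := hτ y x hxy.symm
    have : (Real.pi * I : ℂ) * (τ x y + τ y x) = Real.pi * I * 1 := by
      linear_combination (-1/2 : ℂ) * h1 + (-1/2 : ℂ) * h2
    exact_mod_cast mul_left_cancel₀ hpi this
  · have hα : ∀ s, α.extend s ∈ Set.range α := fun s => ⟨Set.projIcc 0 1 zero_le_one s, rfl⟩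
    have hβ : ∀ s, β.extend s ∈ Set.range β := fun s => ⟨Set.projIcc 0 1 zero_le_one s, rfl⟩
    have hne : ∀ x ∈ Set.range α, ∀ y ∈ Set.range β, x ≠ y := fun x hx y hy =>
      hdisj.ne_of_mem hx hy
    obtain ⟨F, hFc, hF⟩ := exists_continuous_log (X := ℝ × ℝ)
      (g := fun p => β.extend p.2 - α.extend p.1) (by fun_prop)
      (fun p => sub_ne_zero.2 (hne _ (hα _) _ (hβ _)).symm)
    have e1 := hm a β (fun t => F (0, t)) (by fun_prop) (fun t => by simp [hF])
    have e2 := hm b β (fun t => F (1, t)) (by fun_prop) (fun t => by simp [hF])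
    have e3 := hm c α (fun s => F (s, 0) + Real.pi * I) (by fun_prop)
      (fun t => by simp [exp_add, hF])
    have e4 := hm d α (fun s => F (s, 1) + Real.pi * I) (by fun_prop)
      (fun t => by simp [exp_add, hF])
    have ha : a ∈ Set.range α := ⟨0, α.source⟩
    have hb : b ∈ Set.range α := ⟨1, α.target⟩
    have hc : c ∈ Set.range β := ⟨0, β.source⟩
    have hd : d ∈ Set.range β := ⟨1, β.target⟩
    have t1 := hτ a c (hne _ ha _ hc)
    have t2 := hτ a d (hne _ ha _ hd)
    have t3 := hτ b d (hne _ hb _ hd)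
    have t4 := hτ b c (hne _ hb _ hc)
    have : (Real.pi * I : ℂ) * (m a β - m b β - m c α + m d α) =
        Real.pi * I * (τ a c - τ a d + τ b d - τ b c) := by
      linear_combination (-1/2 : ℂ) * (e1 - e2 - e3 + e4 - t1 + t2 - t3 + t4)
    exact_mod_cast mul_left_cancel₀ hpi this

/-- There is no plane drawing of `K₅` whose independent edges are disjoint: modulo two, each
deviation occurs twice in the sum of the relations over the pairs of independent edges, whereas the
right-hand sides add up to an odd number. -/
theorem not_exists_drawing_K5 (p : Fin 5 → ℂ) (A : Fin 5 → Fin 5 → Set ℂ)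
    (hA : ∀ i j, i < j → JoinedIn (A i j) (p i) (p j))
    (hd : ∀ i j k l, i < j → k < l → i ≠ k → i ≠ l → j ≠ k → j ≠ l →
      Disjoint (A i j) (A k l)) : False := by
  obtain ⟨τ, m, hτ, hm⟩ := exists_deviation_relation
  have : ∀ i j, ∃ γ : Path (p i) (p j), i < j → Set.range γ ⊆ A i j := by
    intro i j
    by_cases h : i < j
    · exact ⟨(hA i j h).somePath, fun _ => Set.range_subset_iff.2 (hA i j h).somePath_mem⟩
    · exact ⟨PathConnectedSpace.somePath _ _, fun h' => (h h').elim⟩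
  choose γ hγ using this
  -- The three pairs of independent edges on four given vertices contribute an odd number.
  have key : ∀ w x y z, w < x → x < y → y < z → ∃ s : ℤ,
      (m (p w) (γ y z) - m (p x) (γ y z) - m (p y) (γ w x) + m (p z) (γ w x)) +
      (m (p w) (γ x z) - m (p y) (γ x z) - m (p x) (γ w y) + m (p z) (γ w y)) +
      (m (p w) (γ x y) - m (p z) (γ x y) - m (p x) (γ w z) + m (p y) (γ w z)) = 2 * s + 1 := by
    intro w x y z hwx hxy hyz
    have hwy := hwx.trans hxy
    have hxz := hxy.trans hyz
    have hwz := hwx.trans hxz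
    have d1 := hd w x y z hwx hyz hwy.ne hwz.ne hxy.ne hxz.ne
    have d2 := hd w y x z hwy hxz hwx.ne hwz.ne hxy.ne' hyz.ne
    have d3 := hd w z x y hwz hxy hwx.ne hwy.ne hxz.ne' hyz.ne'
    have r1 := hm (γ w x) (γ y z) (d1.mono (hγ _ _ hwx) (hγ _ _ hyz))
    have r2 := hm (γ w y) (γ x z) (d2.mono (hγ _ _ hwy) (hγ _ _ hxz))
    have r3 := hm (γ w z) (γ x y) (d3.mono (hγ _ _ hwz) (hγ _ _ hxy))
    have t1 := hτ _ _ (d1.ne_of_mem (hA _ _ hwx).target_mem (hA _ _ hyz).source_mem)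
    have t2 := hτ _ _ (d1.ne_of_mem (hA _ _ hwx).target_mem (hA _ _ hyz).target_mem)
    have t3 := hτ _ _ (d2.ne_of_mem (hA _ _ hwy).target_mem (hA _ _ hxz).target_mem)
    exact ⟨τ (p w) (p x) - τ (p w) (p z) + τ (p x) (p z) - 1, by linarith⟩
  obtain ⟨s0, h0⟩ := key 1 2 3 4 (by decide) (by decide) (by decide)
  obtain ⟨s1, h1⟩ := key 0 2 3 4 (by decide) (by decide) (by decide)
  obtain ⟨s2, h2⟩ := key 0 1 3 4 (by decide) (by decide) (by decide)
  obtain ⟨s3, h3⟩ := key 0 1 2 4 (by decide) (by decide) (by decide)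
  obtain ⟨s4, h4⟩ := key 0 1 2 3 (by decide) (by decide) (by decide)
  omega

/-- There is no plane drawing of `K₃,₃` whose independent edges are disjoint, by the same count as
for `K₅`. -/
theorem not_exists_drawing_K33 (x y : Fin 3 → ℂ) (A : Fin 3 → Fin 3 → Set ℂ)
    (hA : ∀ i j, JoinedIn (A i j) (x i) (y j))
    (hd : ∀ i j k l, i ≠ k → j ≠ l → Disjoint (A i j) (A k l)) : False := by
  obtain ⟨τ, m, hτ, hm⟩ := exists_deviation_relation
  have : ∀ i j, ∃ γ : Path (x i) (y j), Set.range γ ⊆ A i j := fun i j =>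
    ⟨(hA i j).somePath, Set.range_subset_iff.2 (hA i j).somePath_mem⟩
  choose γ hγ using this
  have key : ∀ i j k l, i ≠ k → j ≠ l → _ := fun i j k l h1 h2 =>
    hm (γ i j) (γ k l) ((hd i j k l h1 h2).mono (hγ i j) (hγ k l))
  -- The two pairs of independent edges on a 4-cycle.
  have key2 : ∀ i j k l, i ≠ k → j ≠ l → 
      (m (x i) (γ k l) - m (y j) (γ k l) - m (x k) (γ i j) + m (y l) (γ i j)) +
      (m (x i) (γ k j) - m (y l) (γ k j) - m (x k) (γ i l) + m (y j) (γ i l)) =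
      2 * τ (x i) (x k) - τ (x i) (y l) - τ (x i) (y j) - τ (y j) (x k) - τ (y l) (x k) + 1 := by
    intro i j k l h1 h2
    have r1 := key i j k l h1 h2
    have r2 := key i l k j h1 h2.symm
    have t := hτ _ _ ((hd i j k l h1 h2).ne_of_mem (hA _ _).target_mem (hA _ _).target_mem)
    linarith
  have t : ∀ i j, τ (x i) (y j) + τ (y j) (x i) = 1 := by
    intro i j
    obtain ⟨k, hk⟩ := exists_ne i
    obtain ⟨l, hl⟩ := exists_ne j
    exact hτ _ _ ((hd i l k j hk.symm hl).ne_of_mem (hA _ _).source_mem (hA _ _).target_mem)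
  have a1 := key2 0 0 1 1 (by decide) (by decide)
  have a2 := key2 0 0 1 2 (by decide) (by decide)
  have a3 := key2 0 1 1 2 (by decide) (by decide)
  have b1 := key2 0 0 2 1 (by decide) (by decide)
  have b2 := key2 0 0 2 2 (by decide) (by decide)
  have b3 := key2 0 1 2 2 (by decide) (by decide)
  have c1 := key2 1 0 2 1 (by decide) (by decide)
  have c2 := key2 1 0 2 2 (by decide) (by decide)
  have c3 := key2 1 1 2 2 (by decide) (by decide)
  have t10 := t 1 0
  have t11 := t 1 1
  have t12 := t 1 2
  omega

/-! ### Cyclic vertex orders and two forbidden configurations -/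

namespace SimpleGraph

variable {V : Type*} {G : SimpleGraph V}

/-- `u` and `v` are joined by a walk all of whose vertices lie in `W`. -/
def JoinedWithin (G : SimpleGraph V) (W : Set V) (u v : V) : Prop :=
  ∃ p : G.Walk u v, ∀ z ∈ p.support, z ∈ W

theorem JoinedWithin.refl {W : Set V} {u : V} (hu : u ∈ W) : G.JoinedWithin W u u :=
  ⟨.nil, by simpa using hu⟩

theorem JoinedWithin.symm {W : Set V} {u v : V} (h : G.JoinedWithin W u v) :
    G.JoinedWithin W v u := by
  obtain ⟨p, hp⟩ := h
  exact ⟨p.reverse, by simpa using hp⟩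

theorem JoinedWithin.trans {W : Set V} {u v w : V} (h : G.JoinedWithin W u v)
    (h' : G.JoinedWithin W v w) : G.JoinedWithin W u w := by
  obtain ⟨p, hp⟩ := h
  obtain ⟨q, hq⟩ := h'
  exact ⟨p.append q, fun z hz => ((Walk.mem_support_append_iff _ _).1 hz).elim (hp z) (hq z)⟩

theorem JoinedWithin.mono {W W' : Set V} {u v : V} (h : G.JoinedWithin W u v) (hW : W ⊆ W') :
    G.JoinedWithin W' u v := by
  obtain ⟨p, hp⟩ := h
  exact ⟨p, fun z hz => hW (hp z hz)⟩

theorem JoinedWithin.of_adj {W : Set V} {u v : V} (h : G.Adj u v) (hu : u ∈ W) (hv : v ∈ W) :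
    G.JoinedWithin W u v :=
  ⟨h.toWalk, by simp [hu, hv]⟩

theorem joinedWithin_of_isChain {l : List V} (h : l.IsChain G.Adj) {u v : V} (hu : u ∈ l)
    (hv : v ∈ l) : G.JoinedWithin {z | z ∈ l} u v := by
  have key : ∀ (l : List V) (a : V), (a :: l).IsChain G.Adj → ∀ v ∈ a :: l,
      G.JoinedWithin {z | z ∈ a :: l} a v := by
    intro l
    induction l with
    | nil => intro a _ v hv; simp only [List.mem_singleton] at hv; subst hv; exact .refl (by simp)
    | cons b l ih =>
      intro a h v hv
      rcases List.mem_cons.1 hv with rfl | hv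
      · exact .refl (by simp)
      · rw [List.isChain_cons_cons] at h
        exact (JoinedWithin.of_adj h.1 (by simp) (by simp)).trans
          ((ih b h.2 v hv).mono fun z hz => List.mem_cons_of_mem _ hz)
  cases l with
  | nil => simp at hu
  | cons a l => exact (key l a h u hu).symm.trans (key l a h v hv)

/-- `G` has no theta configuration: two vertices `x`, `y` and three vertices `v i`, each joined to
`x` within `P i` and to `y` within `Q i`, where `P i` and `Q j` are disjoint for `i ≠ j`. A
subdivided `K₂,₃` is of this kind; the sets `P i` may overlap each other, and so may the `Q i`. -/
def ThetaFree (G : SimpleGraph V) : Prop :=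
  ∀ (x y : V) (v : Fin 3 → V) (P Q : Fin 3 → Set V), (∀ i, G.JoinedWithin (P i) x (v i)) →
    (∀ i, G.JoinedWithin (Q i) y (v i)) → ¬ ∀ i j, i ≠ j → Disjoint (P i) (Q j)

/-- `G` has no tetrahedral configuration: four vertices, any two of them joined within a set, where
the sets belonging to opposite pairs are disjoint. -/
def TetraFree (G : SimpleGraph V) : Prop :=
  ∀ (v : Fin 4 → V) (W : Fin 4 → Fin 4 → Set V),
    (∀ i j, i < j → G.JoinedWithin (W i j) (v i) (v j)) →
    ¬ ∀ i j k l, i < j → k < l → i ≠ k → i ≠ l → j ≠ k → j ≠ l → Disjoint (W i j) (W k l)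

/-- No two edges cross when the vertices are arranged in the order of the list `l`. -/
def NonCrossing (G : SimpleGraph V) (l : List V) : Prop :=
  ∀ a c b d, [a, c, b, d].Sublist l → G.Adj a b → ¬ G.Adj c d

theorem _root_.List.cons_sublist_iff_exists_append {α : Type*} {a : α} {l l' : List α} :
    (a :: l').Sublist l ↔ ∃ s t, l = s ++ a :: t ∧ l'.Sublist t := by
  constructor
  · intro h
    obtain ⟨r₁, r₂, rfl, ha, h'⟩ := List.cons_sublist_iff.1 h
    obtain ⟨s, t, rfl⟩ := List.append_of_mem ha
    exact ⟨s, t ++ r₂, by simp, h'.trans (List.sublist_append_right _ _)⟩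
  · rintro ⟨s, t, rfl, h⟩
    exact (h.cons_cons a).trans (List.sublist_append_right _ _)

theorem NonCrossing.append_singleton {h : V} {t : List V} (hn : G.NonCrossing (h :: t)) :
    G.NonCrossing (t ++ [h]) := by
  intro a c b d hs hab hcd
  rw [List.sublist_append_iff] at hs
  obtain ⟨l₁, l₂, he, h₁, h₂⟩ := hs
  rcases List.sublist_singleton.1 h₂ with rfl | rfl
  · rw [List.append_nil] at he
    subst he
    exact hn a c b d (h₁.cons h) hab hcd
  · have := congrArg List.reverse he
    simp only [List.reverse_cons, List.reverse_append, List.reverse_nil, List.nil_append,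
      List.cons_append, List.cons.injEq] at this
    obtain ⟨rfl, h3⟩ := this
    have h3 := congrArg List.reverse h3
    simp only [List.reverse_reverse, List.reverse_cons, List.reverse_nil, List.nil_append,
      List.cons_append] at h3
    subst h3
    exact hn d a c b (h₁.cons_cons d) hcd.symm hab

theorem NonCrossing.of_isRotated {l l' : List V} (hn : G.NonCrossing l) (h : l ~r l') :
    G.NonCrossing l' := by
  obtain ⟨n, rfl⟩ := h
  induction n with
  | zero => simpa
  | succ n ih =>
    rw [← List.rotate_rotate]
    cases hl : l.rotate n with
    | nil => intro a b c d h; simp at h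
    | cons h t => rw [hl] at ih; simpa using ih.append_singleton

theorem _root_.List.exists_isRotated_cons {α : Type*} {l : List α} {x : α} (h : x ∈ l) :
    ∃ t, l ~r x :: t := by
  obtain ⟨s, t, rfl⟩ := List.append_of_mem h
  exact ⟨t ++ s, by simpa using List.isRotated_append (l := s) (l' := x :: t)⟩

/-- Two noncrossing orders that share only the first vertex can be placed one after the other when
no edge joins their remaining parts. -/
theorem NonCrossing.append {x : V} {A B : List V} (hA : G.NonCrossing (x :: A))
    (hB : G.NonCrossing (x :: B)) (h : ∀ a ∈ A, ∀ b ∈ B, ¬ G.Adj a b) :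
    G.NonCrossing (x :: (A ++ B)) := by
  intro a c b d hs hab hcd
  have hs' : ([a, c, b, d]).Sublist ((x :: A) ++ B) := hs
  obtain ⟨l₁, l₂, he, h₁, h₂⟩ := List.sublist_append_iff.1 hs'
  have tl : ∀ {u : V} {l : List V}, (u :: l).Sublist (x :: A) → ∀ v ∈ l, v ∈ A := by
    intro u l h v hv
    cases h with
    | cons _ h => exact (List.sublist_cons_self _ _ |>.trans h).subset hv
    | cons_cons _ h => exact h.subset hv
  match l₁, he with
  | [], he =>
    simp only [List.nil_append] at he
    subst he
    exact hB a c b d (h₂.cons x) hab hcd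
  | [p], he =>
    simp only [List.cons_append, List.nil_append, List.cons.injEq] at he
    obtain ⟨rfl, rfl⟩ := he
    rcases List.mem_cons.1 (h₁.subset (List.mem_singleton.2 rfl)) with rfl | ha
    · exact hB _ c b d (h₂.cons_cons _) hab hcd
    · exact h _ ha b (h₂.subset (by simp)) hab
  | [p, q], he =>
    simp only [List.cons_append, List.nil_append, List.cons.injEq] at he
    obtain ⟨rfl, rfl, rfl⟩ := he
    exact h c (tl h₁ c (by simp)) d (h₂.subset (by simp)) hcd
  | [p, q, r], he =>
    simp only [List.cons_append, List.nil_append, List.cons.injEq] at he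
    obtain ⟨rfl, rfl, rfl, rfl⟩ := he
    exact h c (tl h₁ c (by simp)) d (h₂.subset (by simp)) hcd
  | [p, q, r, s], he =>
    simp only [List.cons_append, List.nil_append, List.cons.injEq] at he
    obtain ⟨rfl, rfl, rfl, rfl, rfl⟩ := he
    exact hA a c b d h₁ hab hcd
  | p :: q :: r :: s :: t :: l, he => simp at he

/-- An ear whose ends are neighbours on a closed walk makes it longer; otherwise the ear and the two
sides of the closed walk form a theta configuration. -/
theorem ThetaFree.exists_perm_cycleChain (hT : G.ThetaFree) {x y : V} {A B E : List V}
    (hnd : (x :: (A ++ y :: B) ++ E).Nodup) (hc : Cycle.Chain G.Adj (x :: (A ++ y :: B) : List V))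
    (hE : E ≠ []) (hear : (x :: (E ++ [y])).IsChain G.Adj) :
    ∃ l : List V, l.Perm (x :: (A ++ y :: B) ++ E) ∧ Cycle.Chain G.Adj (l : Cycle V) := by
  have hsymm : ∀ {l : List V}, l.IsChain G.Adj → l.reverse.IsChain G.Adj := fun h =>
    (List.isChain_reverse.2 h).imp fun _ _ h => h.symm
  rw [Cycle.chain_coe_cons] at hc
  have hc' : ((x :: A) ++ y :: (B ++ [x])).IsChain G.Adj := by simpa using hc
  rw [List.isChain_split] at hc'
  obtain ⟨hc1, hc2⟩ := hc'
  have hear' : ((x :: E) ++ [y]).IsChain G.Adj := hear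
  match A, B, E with
  | _, _, [] => exact (hE rfl).elim
  | [], B, E =>
    refine ⟨x :: (E ++ y :: B), ?_, ?_⟩
    · simp only [List.nil_append, List.cons_append, List.perm_cons]
      exact List.perm_append_comm
    · rw [Cycle.chain_coe_cons]
      have : ((x :: E) ++ y :: (B ++ [x])).IsChain G.Adj := List.isChain_split.2 ⟨hear', hc2⟩
      simpa using this
  | A, [], E =>
    refine ⟨x :: (A ++ y :: E.reverse), ?_, ?_⟩
    · simp only [List.append_assoc, List.cons_append, List.perm_cons, List.nil_append]
      exact (((List.reverse_perm E).cons y)).append_left A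
    · rw [Cycle.chain_coe_cons]
      have h1 : (y :: (E.reverse ++ [x])).IsChain G.Adj := by simpa using hsymm hear
      have : ((x :: A) ++ y :: (E.reverse ++ [x])).IsChain G.Adj := List.isChain_split.2 ⟨hc1, h1⟩
      simpa using this
  | a :: A, b :: B, e :: E =>
    exfalso
    have hb : (b :: (B ++ [x])).IsChain G.Adj := (List.isChain_cons_cons.1 hc2).2
    have hyb : G.Adj y b := (List.isChain_cons_cons.1 hc2).1
    have ha : (a :: (A ++ [y])).IsChain G.Adj := (List.isChain_cons_cons.1 hc1).2
    have hxa : G.Adj x a := (List.isChain_cons_cons.1 hc1).1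
    have he : (e :: (E ++ [y])).IsChain G.Adj := (List.isChain_cons_cons.1 hear').2
    have hxe : G.Adj x e := (List.isChain_cons_cons.1 hear').1
    refine hT x y ![a, b, e]
      (fun i => {z | z ∈ (![[x, a], b :: (B ++ [x]), [x, e]] : Fin 3 → List V) i})
      (fun i => {z | z ∈ (![a :: (A ++ [y]), [y, b], e :: (E ++ [y])] : Fin 3 → List V) i})
      ?_ ?_ ?_
    · intro i
      fin_cases i
      · exact joinedWithin_of_isChain (by simpa using hxa) (by simp) (by simp)
      · exact joinedWithin_of_isChain hb (by simp) (by simp)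
      · exact joinedWithin_of_isChain (by simpa using hxe) (by simp) (by simp)
    · intro i
      fin_cases i
      · exact joinedWithin_of_isChain ha (by simp) (by simp)
      · exact joinedWithin_of_isChain (by simpa using hyb) (by simp) (by simp)
      · exact joinedWithin_of_isChain he (by simp) (by simp)
    · intro i j hij
      rw [Set.disjoint_left]
      intro z
      fin_cases i <;> fin_cases j <;> first | exact (hij rfl).elim | skip
      all_goals
        simp at hnd ⊢
        grind

/-- A walk from outside a list to one of its members contains an ear ending at the list. -/
theorem JoinedWithin.exists_ear {W : Set V} {w y' : V} (h : G.JoinedWithin W w y') {A : List V}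
    (hw : w ∉ A) (hy' : y' ∈ A) : ∃ (E : List V) (y : V), y ∈ A ∧ (w :: E).Nodup ∧
      (∀ z ∈ w :: E, z ∈ W ∧ z ∉ A) ∧ (w :: (E ++ [y])).IsChain G.Adj := by
  classical
  have key : ∀ {w y' : V} (p : G.Walk w y'), y' ∈ A → p.IsPath → w ∉ A → ∃ (E : List V) (y : V), y ∈ A ∧
      (w :: E).Nodup ∧ (∀ z ∈ w :: E, z ∈ p.support ∧ z ∉ A) ∧
      (w :: (E ++ [y])).IsChain G.Adj := by
    intro w y' p hy'
    induction p with
    | nil => intro _ h; exact (h hy').elim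
    | @cons u v _ huv p ih =>
      intro hp hu
      rw [Walk.cons_isPath_iff] at hp
      by_cases hv : v ∈ A
      · exact ⟨[], v, hv, by simp, by simp [hu], by simpa using huv⟩
      · obtain ⟨E, y, hy, hnd, hE, hch⟩ := ih hy' hp.1 hv
        refine ⟨v :: E, y, hy, List.nodup_cons.2 ⟨fun h => hp.2 (hE u h).1, hnd⟩, ?_, ?_⟩
        · intro z hz
          rcases List.mem_cons.1 hz with rfl | hz
          · simp [hu]
          · exact ⟨by simp [(hE z hz).1], (hE z hz).2⟩
        · exact List.isChain_cons_cons.2 ⟨huv, hch⟩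
  obtain ⟨p, hp⟩ := h
  obtain ⟨E, y, hy, hnd, hE, hch⟩ := key p.bypass hy' p.bypass_isPath hw
  exact ⟨E, y, hy, hnd, fun z hz => ⟨hp z (p.support_bypass_subset_support (hE z hz).1), (hE z hz).2⟩, hch⟩

/-- The vertex set `S` stays connected when any one of its vertices is removed. -/
def ConnectedWithoutVertex (G : SimpleGraph V) (S : Finset V) : Prop :=
  ∀ x ∈ S, ∀ w ∈ S, w ≠ x → ∀ y ∈ S, y ≠ x → G.JoinedWithin (S \ {x} : Set V) w y

/-- Closed walks without repetition grow, ear by ear, from a single edge traversed back and forth to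
a Hamiltonian one. -/
theorem ConnectedWithoutVertex.exists_cycleChain [DecidableEq V] {S : Finset V}
    (H : G.ConnectedWithoutVertex S)
    (hT : G.ThetaFree) (hS : 3 ≤ S.card) {k : ℕ} (hk : 2 ≤ k) (hkS : k ≤ S.card) :
    ∃ l : List V, l.Nodup ∧ (∀ z ∈ l, z ∈ S) ∧ Cycle.Chain G.Adj (l : Cycle V) ∧
      k ≤ l.length := by
  have third : ∀ a b, ∃ t ∈ S, t ≠ a ∧ t ≠ b := by
    intro a b
    by_contra! hcon
    have : S ⊆ {a, b} := fun t ht => by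
      by_cases h : t = a
      · simp [h]
      · simp [hcon t ht h]
    have := (Finset.card_le_card this).trans Finset.card_le_two
    omega
  induction k, hk using Nat.le_induction with
  | base =>
    obtain ⟨x, hx, y, hy, hxy⟩ := Finset.one_lt_card.1 (show 1 < S.card by omega)
    obtain ⟨t, ht, htx, hty⟩ := third x y
    obtain ⟨p, hp⟩ := H t ht x hx htx.symm y hy hty.symm
    cases p with
    | nil => exact (hxy rfl).elim
    | @cons _ z _ hxz p =>
      refine ⟨[x, z], by simpa using hxz.ne, ?_, ?_, by simp⟩
      · intro u hu
        have hz : z ∈ S := (hp z (by simp)).1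
        simp only [List.mem_cons, List.not_mem_nil, or_false] at hu
        rcases hu with rfl | rfl <;> assumption
      · rw [Cycle.chain_coe_cons]
        simpa using ⟨hxz, hxz.symm⟩
  | succ k hk ih =>
    obtain ⟨l, hnd, hlS, hc, hlen⟩ := ih (by omega)
    by_cases hlt : k + 1 ≤ l.length
    · exact ⟨l, hnd, hlS, hc, hlt⟩
    obtain ⟨z, hz, hzl⟩ : ∃ z ∈ S, z ∉ l := by
      by_contra! hcon
      have h1 : S ⊆ l.toFinset := fun z hz => List.mem_toFinset.2 (hcon z hz)
      have := (Finset.card_le_card h1).trans (List.toFinset_card_le l)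
      omega
    obtain ⟨x₀, hx₀⟩ : ∃ x, x ∈ l := List.exists_mem_of_length_pos (by omega)
    obtain ⟨t, ht, htx, htz⟩ := third x₀ z
    obtain ⟨p, hp⟩ := H t ht x₀ (hlS _ hx₀) htx.symm z hz htz.symm
    obtain ⟨⟨⟨x, w⟩, hxw⟩, hd, hxl, hwl⟩ := p.exists_boundary_dart {v | v ∈ l} hx₀ hzl
    have hwS : w ∈ S := (hp w (p.dart_snd_mem_support_of_mem_darts hd)).1
    simp only [Set.mem_ofPred_eq] at hxl hwl
    obtain ⟨A', hrot⟩ := List.exists_isRotated_cons hxl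
    have hmem : ∀ z, z ∈ l ↔ z ∈ x :: A' := fun z => hrot.mem_iff
    have hnd' : (x :: A').Nodup := hrot.nodup_iff.1 hnd
    have hlen' : l.length = (x :: A').length := hrot.perm.length_eq
    rw [Cycle.coe_eq_coe.2 hrot] at hc
    obtain ⟨y', hy'⟩ : ∃ y, y ∈ A' := List.exists_mem_of_length_pos (by
      simp only [List.length_cons] at hlen'; omega)
    have hxS := hlS x hxl
    have hxA : x ∉ A' := (List.nodup_cons.1 hnd').1
    have hwA : w ∉ A' := fun h => hwl ((hmem w).2 (List.mem_cons_of_mem _ h))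
    obtain ⟨E, y, hy, hEnd, hE, hch⟩ := (H x hxS w hwS hxw.ne' y'
      (hlS _ ((hmem y').2 (List.mem_cons_of_mem _ hy'))) (fun h => hxA (h ▸ hy'))).exists_ear hwA hy'
    obtain ⟨A, B, rfl⟩ := List.append_of_mem hy
    have hfull : (x :: (A ++ y :: B) ++ (w :: E)).Nodup := by
      refine List.nodup_append'.2 ⟨hnd', hEnd, ?_⟩
      intro z hz hzE
      rcases List.mem_cons.1 hz with rfl | hz
      · exact (hE z hzE).1.2 rfl
      · exact (hE z hzE).2 hz
    obtain ⟨l', hperm, hc'⟩ := hT.exists_perm_cycleChain hfull hc (by simp)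
      (List.isChain_cons_cons.2 ⟨hxw, hch⟩)
    refine ⟨l', hperm.nodup_iff.2 hfull, fun z hz => ?_, hc', ?_⟩
    · rcases List.mem_append.1 (hperm.mem_iff.1 hz) with hz | hz
      · exact hlS z ((hmem z).2 hz)
      · exact (hE z hz).1.1
    · rw [hperm.length_eq, List.length_append, ← hlen', List.length_cons]
      omega

/-- Crossing chords of a closed walk form a tetrahedral configuration with it. -/
theorem TetraFree.nonCrossing_of_cycleChain (hK : G.TetraFree) {l : List V} (hnd : l.Nodup)
    (hc : Cycle.Chain G.Adj (l : Cycle V)) : G.NonCrossing l := by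
  intro a c b d hs hab hcd
  obtain ⟨L0, t0, rfl, hs1⟩ := List.cons_sublist_iff_exists_append.1 hs
  obtain ⟨L1, t1, rfl, hs2⟩ := List.cons_sublist_iff_exists_append.1 hs1
  obtain ⟨L2, t2, rfl, hs3⟩ := List.cons_sublist_iff_exists_append.1 hs2
  obtain ⟨L3, L4, rfl, -⟩ := List.cons_sublist_iff_exists_append.1 hs3
  have hrot := List.isRotated_append (l := L0) (l' := a :: (L1 ++ c :: (L2 ++ b :: (L3 ++ d :: L4))))
  rw [hrot.nodup_iff] at hnd
  rw [Cycle.coe_eq_coe.2 hrot, List.cons_append, Cycle.chain_coe_cons] at hc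
  clear hrot hs hs1 hs2 hs3
  simp only [List.cons_append, List.append_assoc, List.nodup_cons, List.nodup_append,
    List.mem_cons, List.mem_append] at hnd
  have e1 : Disjoint {z | z ∈ a :: L1 ++ [c]} {z | z ∈ b :: L3 ++ [d]} := by
    clear hc
    rw [Set.disjoint_left]
    grind
  have e2 : Disjoint {z | z ∈ [a, b]} {z | z ∈ [c, d]} := by
    clear hc
    rw [Set.disjoint_left]
    grind
  have e3 : Disjoint {z | z ∈ d :: (L4 ++ L0 ++ [a])} {z | z ∈ c :: L2 ++ [b]} := by
    clear hc
    rw [Set.disjoint_left]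
    grind
  have h1 : ((a :: L1) ++ c :: (L2 ++ b :: (L3 ++ d :: (L4 ++ L0 ++ [a])))).IsChain G.Adj := by
    simpa using hc
  obtain ⟨hac, h2⟩ := List.isChain_split.1 h1
  have h2 : ((c :: L2) ++ b :: (L3 ++ d :: (L4 ++ L0 ++ [a]))).IsChain G.Adj := h2
  obtain ⟨hcb, h3⟩ := List.isChain_split.1 h2
  have h3 : ((b :: L3) ++ d :: (L4 ++ L0 ++ [a])).IsChain G.Adj := h3
  obtain ⟨hbd, hda⟩ := List.isChain_split.1 h3
  refine hK ![a, c, b, d] (fun i j => {z | z ∈ (![![[], a :: L1 ++ [c], [a, b],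
    d :: (L4 ++ L0 ++ [a])], ![[], [], c :: L2 ++ [b], [c, d]], ![[], [], [], b :: L3 ++ [d]],
    ![[], [], [], []]] : Fin 4 → Fin 4 → List V) i j}) ?_ ?_
  · intro i j hij
    fin_cases i <;> fin_cases j <;> first | exact absurd hij (by decide) | skip
    · exact joinedWithin_of_isChain hac (by simp) (by simp)
    · exact joinedWithin_of_isChain (by simpa using hab) (by simp) (by simp)
    · exact joinedWithin_of_isChain hda (by simp) (by simp)
    · exact joinedWithin_of_isChain hcb (by simp) (by simp)
    · exact joinedWithin_of_isChain (by simpa using hcd) (by simp) (by simp)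
    · exact joinedWithin_of_isChain hbd (by simp) (by simp)
  · intro i j k l h1 h2 h3 h4 h5 h6
    fin_cases i <;> fin_cases j <;> first | exact absurd h1 (by decide) | skip
    all_goals
      fin_cases k <;> first | exact absurd rfl h3 | exact absurd rfl h5 | skip
    all_goals
      fin_cases l <;> first | exact absurd h2 (by decide) | exact absurd rfl h4 |
        exact absurd rfl h6 | skip
    exacts [e1, e2, e3, e3.symm, e2.symm, e1.symm]

/-- A finite graph without theta and tetrahedral configurations has a noncrossing vertex order. At a
cut vertex the orders of the two sides are glued; without cut vertices, a longest closed walk is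
Hamiltonian, and its order is noncrossing. -/
theorem exists_nonCrossing (hT : G.ThetaFree) (hK : G.TetraFree) (S : Finset V) :
    ∃ l : List V, l.Nodup ∧ (∀ v, v ∈ l ↔ v ∈ S) ∧ G.NonCrossing l := by
  classical
  induction S using Finset.strongInduction with
  | H S ih =>
  by_cases hS : S.card ≤ 2
  · refine ⟨S.toList, S.nodup_toList, by simp, fun a c b d h => ?_⟩
    have := h.length_le
    simp at this
    omega
  by_cases H : G.ConnectedWithoutVertex S
  · obtain ⟨l, hnd, hlS, hc, hlen⟩ := H.exists_cycleChain hT (by omega) (by omega) le_rfl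
    refine ⟨l, hnd, fun v => ⟨hlS v, fun hv => ?_⟩, hK.nonCrossing_of_cycleChain hnd hc⟩
    have h1 : l.toFinset ⊆ S := fun z hz => hlS z (List.mem_toFinset.1 hz)
    have h2 := Finset.eq_of_subset_of_card_le h1 (by rwa [List.toFinset_card_of_nodup hnd])
    rw [← h2] at hv
    exact List.mem_toFinset.1 hv
  · simp only [ConnectedWithoutVertex, not_forall] at H
    obtain ⟨x, hx, w, hw, hwx, y, hy, hyx, hwy⟩ := H
    set J : V → Prop := fun z => G.JoinedWithin (S \ {x} : Set V) w z with hJ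
    have hJw : J w := .refl ⟨hw, hwx⟩
    have hstep : ∀ a b, J a → b ∈ S → b ≠ x → G.Adj a b → J b := by
      intro a b ha hb hbx hab
      obtain ⟨p, hp⟩ := id ha
      exact ha.trans (.of_adj hab (hp a p.end_mem_support) ⟨hb, hbx⟩)
    obtain ⟨l₁, hnd₁, hm₁, hn₁⟩ := ih (S.filter fun z => z = x ∨ J z)
      (Finset.filter_ssubset.2 ⟨y, hy, by simpa [hyx] using hwy⟩)
    obtain ⟨l₂, hnd₂, hm₂, hn₂⟩ := ih (S.filter fun z => z = x ∨ ¬ J z)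
      (Finset.filter_ssubset.2 ⟨w, hw, by simpa [hwx] using hJw⟩)
    obtain ⟨A, hA⟩ := List.exists_isRotated_cons ((hm₁ x).2 (by simp [hx]))
    obtain ⟨B, hB⟩ := List.exists_isRotated_cons ((hm₂ x).2 (by simp [hx]))
    rw [hA.nodup_iff] at hnd₁
    rw [hB.nodup_iff] at hnd₂
    have hmA : ∀ v, v ∈ A ↔ v ∈ S ∧ v ≠ x ∧ J v := by
      intro v
      have h1 := hm₁ v
      rw [hA.mem_iff] at h1
      have hxA := (List.nodup_cons.1 hnd₁).1
      simp only [List.mem_cons, Finset.mem_filter] at h1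
      by_cases hv : v = x
      · subst hv; simp [hxA]
      · simpa [hv] using h1
    have hmB : ∀ v, v ∈ B ↔ v ∈ S ∧ v ≠ x ∧ ¬ J v := by
      intro v
      have h1 := hm₂ v
      rw [hB.mem_iff] at h1
      have hxB := (List.nodup_cons.1 hnd₂).1
      simp only [List.mem_cons, Finset.mem_filter] at h1
      by_cases hv : v = x
      · subst hv; simp [hxB]
      · simpa [hv] using h1
    refine ⟨x :: (A ++ B), ?_, fun v => ?_, ?_⟩
    · have hd : A.Disjoint B := fun v h1 h2 => ((hmB v).1 h2).2.2 ((hmA v).1 h1).2.2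
      rw [List.nodup_cons] at hnd₁ hnd₂ ⊢
      exact ⟨by simp [hnd₁.1, hnd₂.1], hnd₁.2.append hnd₂.2 hd⟩
    · simp only [List.mem_cons, List.mem_append, hmA, hmB]
      by_cases hv : v = x
      · subst hv; simp [hx]
      · by_cases hJv : J v <;> simp [hv, hJv]
    · refine (hn₁.of_isRotated hA).append (hn₂.of_isRotated hB) fun a ha b hb hab => ?_
      exact ((hmB b).1 hb).2.2
        (hstep a b ((hmA a).1 ha).2.2 ((hmB b).1 hb).1 ((hmB b).1 hb).2.1 hab)

end SimpleGraph

/-! ### Outerplanar embeddings avoid the forbidden configurations -/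

/-- The complement of a closed disc centred at the origin is connected. -/
theorem isPreconnected_lt_norm {R : ℝ} (hR : 0 ≤ R) : IsPreconnected {z : ℂ | R < ‖z‖} := by
  have h : IsPreconnected ((fun p : ℝ × ℝ => (p.1 : ℂ) * Complex.exp (p.2 * Complex.I)) ''
      (Set.Ioi R ×ˢ Set.univ)) :=
    (isPreconnected_Ioi.prod isPreconnected_univ).image _ (by fun_prop)
  convert! h using 1
  ext z
  constructor
  · intro hz
    exact ⟨(‖z‖, z.arg), ⟨hz, trivial⟩, Complex.norm_mul_exp_arg_mul_I z⟩
  · rintro ⟨⟨r, t⟩, ⟨hr, -⟩, rfl⟩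
    simp only [Set.mem_Ioi] at hr
    simpa [abs_of_pos (hR.trans_lt hr)] using hr

namespace PlaneEmbedding

variable {V : Type*} {G : SimpleGraph V} (D : PlaneEmbedding G)

theorem isCompact_arc (e : G.edgeSet) : IsCompact (D.arc e) := by
  obtain ⟨e, he⟩ := e
  induction e with
  | _ a b =>
    obtain ⟨γ, -, hγ⟩ := D.isPlaneArc a b he
    rw [← hγ]
    exact isCompact_range γ.continuous

theorem isCompact_support [Finite V] : IsCompact D.support :=
  (Set.finite_range _).isCompact.union (isCompact_iUnion D.isCompact_arc)

/-- Outside a disc that contains the embedded graph, everything belongs to one component. -/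
theorem lt_norm_subset_connectedComponentIn {R : ℝ} (hR : 0 ≤ R)
    (hsupp : ∀ z ∈ D.support, ‖z‖ ≤ R) {z : ℂ} (hz : R < ‖z‖) :
    {z : ℂ | R < ‖z‖} ⊆ connectedComponentIn D.supportᶜ z :=
  (isPreconnected_lt_norm hR).subset_connectedComponentIn hz
    fun _ hw hmem => (hsupp _ hmem).not_gt hw

theorem outerFace_eq_connectedComponentIn [Finite V] {z : ℂ} (hz : z ∈ D.outerFace) :
    D.outerFace = connectedComponentIn D.supportᶜ z := by
  obtain ⟨R₀, hR₀⟩ := D.isCompact_support.isBounded.exists_norm_le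
  have hsupp : ∀ z ∈ D.support, ‖z‖ ≤ max R₀ 0 := fun z hz => (hR₀ z hz).trans (le_max_left _ _)
  -- Every unbounded component reaches beyond a large disc.
  have key : ∀ w ∈ D.outerFace, ∃ w', max R₀ 0 < ‖w'‖ ∧
      connectedComponentIn D.supportᶜ w = connectedComponentIn D.supportᶜ w' := by
    intro w hw
    obtain ⟨w', hw', hlt⟩ : ∃ w' ∈ connectedComponentIn D.supportᶜ w, max R₀ 0 < ‖w'‖ := by
      by_contra! hcon
      exact hw.2 (isBounded_iff_forall_norm_le.2 ⟨_, hcon⟩)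
    exact ⟨w', hlt, connectedComponentIn_eq hw'⟩
  obtain ⟨z', hz', hzz'⟩ := key z hz
  ext w
  constructor
  · intro hw
    obtain ⟨w', hw', hww'⟩ := key w hw
    have : w' ∈ connectedComponentIn D.supportᶜ z :=
      hzz' ▸ D.lt_norm_subset_connectedComponentIn (le_max_right _ _) hsupp hz' hw'
    rw [connectedComponentIn_eq this, ← hww']
    exact mem_connectedComponentIn hw.1
  · intro hw
    refine ⟨connectedComponentIn_subset _ _ hw, ?_⟩
    rw [← connectedComponentIn_eq hw]
    exact hz.2

/-- The part of the drawing that belongs to the subgraph induced on `W`. -/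
def trace (W : Set V) : Set ℂ :=
  D.point '' W ∪ ⋃ (e : G.edgeSet) (_ : ∀ v ∈ (e : Sym2 V), v ∈ W), D.arc e

variable {D} in
theorem mem_trace {W : Set V} {z : ℂ} : z ∈ D.trace W ↔
    (∃ v ∈ W, D.point v = z) ∨ ∃ e : G.edgeSet, (∀ v ∈ (e : Sym2 V), v ∈ W) ∧ z ∈ D.arc e := by
  simp [trace]

theorem trace_mono {W W' : Set V} (h : W ⊆ W') : D.trace W ⊆ D.trace W' := by
  intro z hz
  rw [mem_trace] at hz ⊢
  exact hz.imp (fun ⟨v, hv, hz⟩ => ⟨v, h hv, hz⟩) (fun ⟨e, he, hz⟩ => ⟨e, fun v hv => h (he v hv), hz⟩)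

theorem trace_subset_support (W : Set V) : D.trace W ⊆ D.support := by
  intro z hz
  rcases mem_trace.1 hz with ⟨v, -, rfl⟩ | ⟨e, -, hz⟩
  · exact Or.inl ⟨v, rfl⟩
  · exact Or.inr (Set.mem_iUnion.2 ⟨e, hz⟩)

theorem isClosed_trace [Finite V] (W : Set V) : IsClosed (D.trace W) :=
  (Set.toFinite _).isClosed.union <| isClosed_iUnion_of_finite fun e =>
    isClosed_iUnion_of_finite fun _ => (D.isCompact_arc e).isClosed

theorem point_notMem_trace_compl (v : V) : D.point v ∉ D.trace {v}ᶜ := by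
  intro h
  rcases mem_trace.1 h with ⟨w, hw, h⟩ | ⟨e, he, h⟩
  · exact hw (D.point_injective h)
  · exact he v (D.mem_of_point_mem_arc e v h) rfl

theorem disjoint_trace {W W' : Set V} (h : Disjoint W W') : Disjoint (D.trace W) (D.trace W') := by
  rw [Set.disjoint_left] at h ⊢
  intro z hz hz'
  rcases mem_trace.1 hz with ⟨v, hv, rfl⟩ | ⟨e, he, hze⟩ <;>
    rcases mem_trace.1 hz' with ⟨v', hv', h'⟩ | ⟨e', he', hze'⟩
  · exact h hv (D.point_injective h' ▸ hv')
  · exact h hv (he' v (D.mem_of_point_mem_arc e' v hze'))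
  · subst h'
    exact h (he v' (D.mem_of_point_mem_arc e v' hze)) hv'
  · have hne : e ≠ e' := by
      rintro rfl
      obtain ⟨a, ha⟩ : ∃ a, a ∈ (e : Sym2 V) := ⟨_, Sym2.out_fst_mem _⟩
      exact h (he a ha) (he' a ha)
    obtain ⟨v, ⟨hv, hv'⟩, -⟩ := D.arc_inter_arc e e' hne ⟨hze, hze'⟩
    exact h (he v hv) (he' v hv')

theorem joinedIn_trace {W : Set V} {u v : V} (h : G.JoinedWithin W u v) :
    JoinedIn (D.trace W) (D.point u) (D.point v) := by
  obtain ⟨p, hp⟩ := h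
  induction p with
  | nil => exact .refl (mem_trace.2 (Or.inl ⟨_, hp _ (by simp), rfl⟩))
  | @cons u w v huw p ih =>
    refine JoinedIn.trans ?_ (ih fun z hz => hp z (by simp [hz]))
    obtain ⟨γ, -, hγ⟩ := D.isPlaneArc u w huw
    refine ⟨γ, fun t => mem_trace.2 (Or.inr ⟨⟨s(u, w), huw⟩, ?_, hγ ▸ ⟨t, rfl⟩⟩)⟩
    intro x hx
    rcases Sym2.mem_iff.1 hx with rfl | rfl
    · exact hp _ (by simp)
    · exact hp _ (by simp)

/-- A point of the outer face can be joined to every vertex `v` on its boundary so that the path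
meets only the point of `v` and the arcs at `v`: follow the outer face to a point near `v`, and then
a segment. The segment may cross arcs at `v`, so that `v` need not be accessible from the face. -/
theorem exists_joinedIn_compl_trace [Finite V] [Nonempty V]
    (hD : ∀ v, D.point v ∈ frontier D.outerFace) :
    ∃ u₀, ∀ v, JoinedIn (D.trace {v}ᶜ)ᶜ u₀ (D.point v) := by
  obtain ⟨u₀, hu₀⟩ : D.outerFace.Nonempty := by
    rw [← closure_nonempty_iff]
    exact ⟨_, frontier_subset_closure (hD (Classical.arbitrary V))⟩
  refine ⟨u₀, fun v => ?_⟩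
  have hopen : IsOpen (D.trace {v}ᶜ)ᶜ := (D.isClosed_trace _).isOpen_compl
  obtain ⟨ε, hε, hball⟩ := Metric.isOpen_iff.1 hopen _ (D.point_notMem_trace_compl v)
  obtain ⟨u, hu, huv⟩ := Metric.mem_closure_iff.1 (frontier_subset_closure (hD v)) ε hε
  have hU := D.outerFace_eq_connectedComponentIn hu₀
  have hUo : IsOpen D.outerFace := hU ▸ D.isCompact_support.isClosed.isOpen_compl.connectedComponentIn
  have hUc : IsConnected D.outerFace := hU ▸ isConnected_connectedComponentIn_iff.2 hu₀.1
  have h1 : JoinedIn D.outerFace u₀ u :=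
    (hUo.isConnected_iff_isPathConnected.1 hUc).joinedIn _ hu₀ _ hu
  have h2 : JoinedIn (Metric.ball (D.point v) ε) u (D.point v) :=
    ((convex_ball _ _).isPathConnected ⟨_, Metric.mem_ball_self hε⟩).joinedIn _
      (by rwa [Metric.mem_ball, dist_comm]) _ (Metric.mem_ball_self hε)
  exact (h1.mono fun z hz hz' => hz.1 (D.trace_subset_support _ hz')).trans (h2.mono hball)

end PlaneEmbedding

theorem SimpleGraph.JoinedWithin.mem_left {V : Type*} {G : SimpleGraph V} {W : Set V} {u v : V}
    (h : G.JoinedWithin W u v) : u ∈ W := by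
  obtain ⟨p, hp⟩ := h
  exact hp _ p.start_mem_support

theorem PlaneEmbedding.disjoint_trace_compl_trace {V : Type*} {G : SimpleGraph V}
    (D : PlaneEmbedding G) {W : Set V} {v : V} (h : v ∉ W) :
    Disjoint (D.trace W) (D.trace {v}ᶜ)ᶜ :=
  Set.disjoint_compl_right_iff_subset.2 (D.trace_mono fun _ hw hwv => h (hwv ▸ hw))

/-- A theta configuration together with a point of the outer face would give a drawing of `K₃,₃`. -/
theorem IsOuterplanar.thetaFree {V : Type*} [Finite V] {G : SimpleGraph V} (h : IsOuterplanar G) :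
    G.ThetaFree := by
  obtain ⟨D, hD⟩ := h
  intro x y v P Q hP hQ hPQ
  have : Nonempty V := ⟨x⟩
  obtain ⟨u₀, hu₀⟩ := D.exists_joinedIn_compl_trace hD
  have hvP : ∀ i j, i ≠ j → v i ∉ P j := fun i j hij hmem =>
    Set.disjoint_left.1 (hPQ j i hij.symm) hmem (hQ i).symm.mem_left
  have hvQ : ∀ i j, i ≠ j → v i ∉ Q j := fun i j hij hmem =>
    Set.disjoint_left.1 (hPQ i j hij) (hP i).symm.mem_left hmem
  refine not_exists_drawing_K33 ![D.point x, D.point y, u₀] (fun j => D.point (v j))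
    ![fun j => D.trace (P j), fun j => D.trace (Q j), fun j => (D.trace {v j}ᶜ)ᶜ] ?_ ?_
  · intro i j
    fin_cases i
    · exact D.joinedIn_trace (hP j)
    · exact D.joinedIn_trace (hQ j)
    · exact hu₀ (v j)
  · intro i j k l hik hjl
    fin_cases i <;> fin_cases k <;> first | exact absurd rfl hik | skip
    · exact D.disjoint_trace (hPQ j l hjl)
    · exact D.disjoint_trace_compl_trace (hvP l j hjl.symm)
    · exact D.disjoint_trace (hPQ l j hjl.symm).symm
    · exact D.disjoint_trace_compl_trace (hvQ l j hjl.symm)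
    · exact (D.disjoint_trace_compl_trace (hvP j l hjl)).symm
    · exact (D.disjoint_trace_compl_trace (hvQ j l hjl)).symm

/-- A tetrahedral configuration together with a point of the outer face would give a drawing of
`K₅`. -/
theorem IsOuterplanar.tetraFree {V : Type*} [Finite V] {G : SimpleGraph V} (h : IsOuterplanar G) :
    G.TetraFree := by
  obtain ⟨D, hD⟩ := h
  intro v W hW hd
  have : Nonempty V := ⟨v 0⟩
  obtain ⟨u₀, hu₀⟩ := D.exists_joinedIn_compl_trace hD
  have hvW : ∀ j k l, k < l → j ≠ k → j ≠ l → v j ∉ W k l := by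
    intro j k l hkl hjk hjl hmem
    obtain ⟨m, hmj, hmk, hml⟩ : ∃ m, m ≠ j ∧ m ≠ k ∧ m ≠ l := by
      clear * -
      revert j k l
      decide
    rcases lt_or_gt_of_ne hmj with hlt | hlt
    · exact Set.disjoint_left.1 (hd m j k l hlt hkl hmk hml hjk hjl) (hW m j hlt).symm.mem_left hmem
    · exact Set.disjoint_left.1 (hd j m k l hlt hkl hjk hjl hmk hml) (hW j m hlt).mem_left hmem
  refine not_exists_drawing_K5 (Fin.cases u₀ fun i => D.point (v i))
    (Fin.cases (Fin.cases ∅ fun j => (D.trace {v j}ᶜ)ᶜ)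
      fun i => Fin.cases ∅ fun j => D.trace (W i j)) ?_ ?_
  · intro i j hij
    induction j using Fin.cases with
    | zero => simp at hij
    | succ j =>
    induction i using Fin.cases with
    | zero => exact hu₀ (v j)
    | succ i => exact D.joinedIn_trace (hW i j (by simpa using hij))
  · intro i j k l hij hkl hik hil hjk hjl
    induction j using Fin.cases with
    | zero => simp at hij
    | succ j =>
    induction l using Fin.cases with
    | zero => simp at hkl
    | succ l =>
    have hjl' : j ≠ l := by simpa using hjl
    induction i using Fin.cases with
    | zero =>
      induction k using Fin.cases with
      | zero => exact absurd rfl hik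
      | succ k =>
        exact (D.disjoint_trace_compl_trace
          (hvW j k l (by simpa using hkl) (by simpa using hjk) hjl')).symm
    | succ i =>
      have hij' : i < j := by simpa using hij
      induction k using Fin.cases with
      | zero =>
        exact D.disjoint_trace_compl_trace (hvW l i j hij' (by simpa using hil.symm) hjl'.symm)
      | succ k =>
        exact D.disjoint_trace (hd i j k l hij' (by simpa using hkl) (by simpa using hik)
          (by simpa using hil) (by simpa using hjk) hjl')

/-! ### From a noncrossing order to an unlinked circle embedding -/

theorem Circle.exp_ne_exp {s t : ℝ} (hst : s < t) (hts : t < s + 2 * Real.pi) :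
    Circle.exp s ≠ Circle.exp t := by
  intro h
  obtain ⟨m, hm⟩ := Circle.exp_eq_exp.1 h
  have hpi := Real.pi_pos
  have h1 : (m : ℝ) < 0 := by
    by_contra! h0
    nlinarith
  have h2 : (-1 : ℝ) < m := by
    by_contra! h0
    nlinarith
  have h1' : m < 0 := by exact_mod_cast h1
  have h2' : -1 < m := by exact_mod_cast h2
  omega

/-- Two points of an open arc of the circle lie in one component of the complement of its ends. -/
theorem Circle.connectedComponentIn_exp_eq {α β γ δ : ℝ} (hβ : β ≤ α + 2 * Real.pi)
    (hγ : γ ∈ Set.Ioo α β) (hδ : δ ∈ Set.Ioo α β) :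
    connectedComponentIn ({Circle.exp α, Circle.exp β}ᶜ : Set Circle) (Circle.exp γ) =
      connectedComponentIn ({Circle.exp α, Circle.exp β}ᶜ : Set Circle) (Circle.exp δ) := by
  refine connectedComponentIn_eq ?_
  have hpre : IsPreconnected (Circle.exp '' Set.Ioo α β) :=
    isPreconnected_Ioo.image _ (by fun_prop)
  refine hpre.subset_connectedComponentIn ⟨γ, hγ, rfl⟩ ?_ ⟨δ, hδ, rfl⟩
  rintro _ ⟨s, ⟨hs1, hs2⟩, rfl⟩ hmem
  rcases hmem with h | h
  · exact Circle.exp_ne_exp hs1 (by linarith) h.symm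
  · exact Circle.exp_ne_exp hs2 (by linarith) h

theorem SimpleGraph.NonCrossing.not_isIntrinsicallyCircleLinked {V : Type*} {G : SimpleGraph V}
    {l : List V} (hl : ∀ v, v ∈ l) (hn : G.NonCrossing l) :
    ¬ IsIntrinsicallyCircleLinked G := by
  classical
  have hlt : ∀ v, l.idxOf v < l.length := fun v => List.idxOf_lt_length_iff.2 (hl v)
  have hcross : ∀ a c b d, G.Adj a b → G.Adj c d →
      ¬ (l.idxOf a < l.idxOf c ∧ l.idxOf c < l.idxOf b ∧ l.idxOf b < l.idxOf d) := by
    rintro a c b d hab hcd ⟨h1, h2, h3⟩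
    refine hn a c b d ?_ hab hcd
    have := List.map_getElem_sublist (l := l) (is := [⟨_, hlt a⟩, ⟨_, hlt c⟩, ⟨_, hlt b⟩, ⟨_, hlt d⟩])
      (by simp [h1, h2, h3, h1.trans h2, h2.trans h3, (h1.trans h2).trans h3])
    simpa using this
  -- The vertices are placed on an open half circle in the order of the list.
  set t : V → ℝ := fun v => l.idxOf v / (l.length + 1) with ht
  have hpos : (0 : ℝ) < l.length + 1 := by positivity
  have ht0 : ∀ v, 0 ≤ t v := fun v => by positivity
  have ht1 : ∀ v, t v < 1 := fun v => by
    rw [ht, div_lt_one hpos]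
    have : (l.idxOf v : ℝ) < l.length := by exact_mod_cast hlt v
    linarith
  have htlt : ∀ u v, t u < t v ↔ l.idxOf u < l.idxOf v := fun u v => by
    rw [ht, div_lt_div_iff_of_pos_right hpos, Nat.cast_lt]
  have htinj : Function.Injective t := by
    intro u v h
    refine (List.idxOf_inj (hl u)).1 (le_antisymm ?_ ?_)
    · exact not_lt.1 fun h' => ((htlt _ _).2 h').ne' h
    · exact not_lt.1 fun h' => ((htlt _ _).2 h').ne h
  have hpi := Real.pi_gt_three
  have hinj : Function.Injective fun v => Circle.exp (t v) := by
    intro u v h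
    rcases lt_trichotomy (t u) (t v) with h' | h' | h'
    · exact (Circle.exp_ne_exp h' (by linarith [ht0 u, ht1 v]) h).elim
    · exact htinj h'
    · exact (Circle.exp_ne_exp h' (by linarith [ht0 v, ht1 u]) h.symm).elim
  intro hlink
  obtain ⟨a, b, c, d, hab, hcd, hdisj, -, hcomp⟩ := hlink _ hinj
  wlog hlt' : t a < t b generalizing a b
  · refine this b a hab.symm (by rwa [Set.pair_comm]) (by rwa [Set.pair_comm]) ?_
    exact lt_of_le_of_ne (not_lt.1 hlt') (htinj.ne hab.ne')
  apply hcomp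
  have hac : t a ≠ t c := htinj.ne (hdisj.ne_of_mem (by simp) (by simp))
  have had : t a ≠ t d := htinj.ne (hdisj.ne_of_mem (by simp) (by simp))
  have hbc : t b ≠ t c := htinj.ne (hdisj.ne_of_mem (by simp) (by simp))
  have hbd : t b ≠ t d := htinj.ne (hdisj.ne_of_mem (by simp) (by simp))
  have hc := hcross a c b d hab hcd
  have hc' := hcross a d b c hab hcd.symm
  have hc2 := hcross c a d b hcd hab
  have hc2' := hcross d a c b hcd.symm hab
  simp only [← htlt] at hc hc' hc2 hc2'
  have hout : ∀ v, t a ≠ t v → t b ≠ t v → ¬ (t a < t v ∧ t v < t b) →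
      ∃ s ∈ Set.Ioo (t b) (t a + 2 * Real.pi), Circle.exp s = Circle.exp (t v) := by
    intro v h1 h2 h3
    rcases lt_or_gt_of_ne h1 with h | h
    · have : t b < t v := lt_of_le_of_ne (not_lt.1 fun h' => h3 ⟨h, h'⟩) h2
      exact ⟨t v, ⟨this, by linarith [ht0 a, ht1 v]⟩, rfl⟩
    · refine ⟨t v + 2 * Real.pi, ⟨by linarith [ht0 v, ht1 b], by linarith⟩, ?_⟩
      exact Circle.exp_eq_exp.2 ⟨1, by simp⟩
  by_cases hcin : t a < t c ∧ t c < t b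
  · have hdin : t a < t d ∧ t d < t b := by
      constructor
      · exact lt_of_le_of_ne (not_lt.1 fun h => hc2' ⟨h, hcin⟩) had
      · exact lt_of_le_of_ne (not_lt.1 fun h => hc ⟨hcin.1, hcin.2, h⟩) hbd.symm
    exact Circle.connectedComponentIn_exp_eq (by linarith [ht0 a, ht1 b]) hcin hdin
  · have hdout : ¬ (t a < t d ∧ t d < t b) := by
      intro hdin
      rcases lt_or_gt_of_ne hac with h | h
      · exact hc' ⟨hdin.1, hdin.2,
          lt_of_le_of_ne (not_lt.1 fun h' => hcin ⟨h, h'⟩) hbc⟩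
      · exact hc2 ⟨h, hdin⟩
    obtain ⟨s, hs, hs'⟩ := hout c hac hbc hcin
    obtain ⟨s2, hs2, hs2'⟩ := hout d had hbd hdout
    have hper : Circle.exp (t a + 2 * Real.pi) = Circle.exp (t a) :=
      Circle.exp_eq_exp.2 ⟨1, by simp⟩
    have := Circle.connectedComponentIn_exp_eq (by linarith) hs hs2
    rw [hs', hs2', hper, Set.pair_comm] at this
    exact this

/-! ### Drawing a graph with straight chords of the circle -/

/-- The oriented area of the triangle `p`, `q`, `z`, doubled. -/
def orientedArea (p q z : ℂ) : ℝ := (q.re - p.re) * (z.im - p.im) - (q.im - p.im) * (z.re - p.re)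

/-- A line meets the circle in at most two points. -/
theorem eq_or_eq_of_orientedArea_eq_zero {p q z : ℂ} (hp : ‖p‖ = 1) (hq : ‖q‖ = 1) (hz : ‖z‖ = 1)
    (hpq : p ≠ q) (h : orientedArea p q z = 0) : z = p ∨ z = q := by
  have hsq : ∀ w : ℂ, ‖w‖ = 1 → w.re * w.re + w.im * w.im = 1 := fun w hw => by
    rw [← Complex.normSq_apply, Complex.normSq_eq_norm_sq, hw, one_pow]
  have hdist : ∀ z w : ℂ, (z.re - w.re) ^ 2 + (z.im - w.im) ^ 2 = 0 → z = w := fun z w h =>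
    Complex.ext (by nlinarith [sq_nonneg (z.re - w.re), sq_nonneg (z.im - w.im)])
      (by nlinarith [sq_nonneg (z.re - w.re), sq_nonneg (z.im - w.im)])
  have hp := hsq p hp
  have hq := hsq q hq
  have hz := hsq z hz
  rw [orientedArea] at h
  have hW : (q.re - p.re) ^ 2 + (q.im - p.im) ^ 2 ≠ 0 := fun h0 => hpq (hdist q p h0).symm
  -- With `u = z - p` and `w = q - p` parallel, `2 p·u = -|u|²` and `2 p·w = -|w|²` give `w·u = |u|²`.
  have hdot : (q.re - p.re) * (z.re - p.re) + (q.im - p.im) * (z.im - p.im) =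
      (z.re - p.re) ^ 2 + (z.im - p.im) ^ 2 := by
    apply mul_left_cancel₀ hW
    have hu : 2 * (p.re * (z.re - p.re) + p.im * (z.im - p.im)) =
      -((z.re - p.re) ^ 2 + (z.im - p.im) ^ 2) := by linear_combination hz - hp
    have hw : 2 * (p.re * (q.re - p.re) + p.im * (q.im - p.im)) =
      -((q.re - p.re) ^ 2 + (q.im - p.im) ^ 2) := by linear_combination hq - hp
    generalize z.re - p.re = u1 at *
    generalize z.im - p.im = u2 at *
    generalize q.re - p.re = w1 at *
    generalize q.im - p.im = w2 at *
    linear_combination (w1 * u1 + w2 * u2) * hw - (w1 ^ 2 + w2 ^ 2) * hu -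
      (2 * (p.re * w2 - p.im * w1)) * h
  have hprod : ((z.re - p.re) ^ 2 + (z.im - p.im) ^ 2) *
      ((z.re - q.re) ^ 2 + (z.im - q.im) ^ 2) = 0 := by
    have e1 : z.re - q.re = (z.re - p.re) - (q.re - p.re) := by ring
    have e2 : z.im - q.im = (z.im - p.im) - (q.im - p.im) := by ring
    rw [e1, e2]
    generalize z.re - p.re = u1 at *
    generalize z.im - p.im = u2 at *
    generalize q.re - p.re = w1 at *
    generalize q.im - p.im = w2 at *
    linear_combination (-(u1 ^ 2 + u2 ^ 2) + (w1 * u1 + w2 * u2)) * hdot + (w1 * u2 - w2 * u1) * h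
  rcases mul_eq_zero.1 hprod with h | h
  · exact Or.inl (hdist _ _ h)
  · exact Or.inr (hdist _ _ h)

theorem orientedArea_lineMap (p q c d : ℂ) (t : ℝ) :
    orientedArea p q (AffineMap.lineMap c d t) =
      (1 - t) * orientedArea p q c + t * orientedArea p q d := by
  simp [orientedArea, AffineMap.lineMap_apply]
  ring

theorem orientedArea_left (p q : ℂ) : orientedArea p q p = 0 := by simp [orientedArea]

theorem orientedArea_right (p q : ℂ) : orientedArea p q q = 0 := by simp [orientedArea]; ring

theorem orientedArea_eq_zero_of_mem_segment {p q z : ℂ} (h : z ∈ segment ℝ p q) :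
    orientedArea p q z = 0 := by
  rw [segment_eq_image_lineMap] at h
  obtain ⟨t, -, rfl⟩ := h
  simp [orientedArea_lineMap, orientedArea_left, orientedArea_right]

/-- Chords of the circle that do not form a link are disjoint: the ends of the second chord lie on
the same side of the line through the first one. -/
theorem disjoint_segment_of_not_nonSplittableLink {a b c d : Circle} (hnd : [a, b, c, d].Nodup)
    (h : ¬ NonSplittableLink a b c d) :
    Disjoint (segment ℝ (a : ℂ) b) (segment ℝ (c : ℂ) d) := by
  have hcomp : connectedComponentIn ({a, b}ᶜ : Set Circle) c =
      connectedComponentIn ({a, b}ᶜ : Set Circle) d := by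
    by_contra hne
    exact h ⟨hnd, hne⟩
  simp only [List.nodup_cons, List.mem_cons, List.not_mem_nil, or_false, not_or] at hnd
  obtain ⟨⟨hab, hac, had⟩, ⟨hbc, hbd⟩, -⟩ := hnd
  have hab' : (a : ℂ) ≠ b := fun h => hab (Circle.ext h)
  have hc : c ∈ connectedComponentIn ({a, b}ᶜ : Set Circle) c :=
    mem_connectedComponentIn (by simp [Ne.symm hac, Ne.symm hbc])
  have hd : d ∈ connectedComponentIn ({a, b}ᶜ : Set Circle) c :=
    hcomp ▸ mem_connectedComponentIn (by simp [Ne.symm had, Ne.symm hbd])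
  have hcont : Continuous fun z : Circle => orientedArea a b z := by
    unfold orientedArea
    fun_prop
  have hne : ∀ z ∈ connectedComponentIn ({a, b}ᶜ : Set Circle) c, orientedArea a b z ≠ 0 := by
    intro z hz h0
    refine connectedComponentIn_subset _ _ hz ?_
    exact (eq_or_eq_of_orientedArea_eq_zero (Circle.norm_coe a) (Circle.norm_coe b)
      (Circle.norm_coe z) hab' h0).imp Circle.ext Circle.ext
  have hpre : IsPreconnected (connectedComponentIn ({a, b}ᶜ : Set Circle) c) :=
    isPreconnected_connectedComponentIn
  have hno : ∀ x ∈ connectedComponentIn ({a, b}ᶜ : Set Circle) c,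
      ∀ y ∈ connectedComponentIn ({a, b}ᶜ : Set Circle) c,
      orientedArea a b x < 0 → ¬ 0 < orientedArea a b y := by
    intro x hx y hy h1 h2
    obtain ⟨z, hz, hz0⟩ := hpre.intermediate_value hx hy hcont.continuousOn ⟨h1.le, h2.le⟩
    exact hne z hz hz0
  rw [Set.disjoint_left]
  intro z hz hz'
  have h0 := orientedArea_eq_zero_of_mem_segment hz
  rw [segment_eq_image_lineMap] at hz'
  obtain ⟨t, ⟨ht0, ht1⟩, rfl⟩ := hz'
  rw [orientedArea_lineMap] at h0
  rcases lt_or_gt_of_ne (hne c hc) with hc0 | hc0 <;> rcases lt_or_gt_of_ne (hne d hd) with hd0 | hd0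
  · rcases ht0.eq_or_lt with rfl | ht0
    · simp at h0; linarith
    · nlinarith [mul_pos ht0 (neg_pos.2 hd0)]
  · exact hno c hc d hd hc0 hd0
  · exact hno d hd c hc hd0 hc0
  · rcases ht0.eq_or_lt with rfl | ht0
    · simp at h0; linarith
    · nlinarith [mul_pos ht0 hd0]

/-- Two chords of the circle with one common end meet only there. -/
theorem eq_of_mem_segment_of_mem_segment {p q r : Circle} (hpq : p ≠ q) (hpr : p ≠ r) (hqr : q ≠ r)
    {z : ℂ} (hz : z ∈ segment ℝ (p : ℂ) q) (hz' : z ∈ segment ℝ (p : ℂ) r) : z = p := by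
  have h0 := orientedArea_eq_zero_of_mem_segment hz
  rw [segment_eq_image_lineMap] at hz'
  obtain ⟨t, -, rfl⟩ := hz'
  rw [orientedArea_lineMap, orientedArea_left, mul_zero, zero_add] at h0
  rcases mul_eq_zero.1 h0 with rfl | h0
  · simp
  · rcases eq_or_eq_of_orientedArea_eq_zero (Circle.norm_coe p) (Circle.norm_coe q)
      (Circle.norm_coe r) (fun h => hpq (Circle.ext h)) h0 with h | h
    · exact (hpr (Circle.ext h).symm).elim
    · exact (hqr (Circle.ext h).symm).elim

theorem eq_or_eq_of_mem_segment {p q r : Circle} (hpq : p ≠ q) (h : (r : ℂ) ∈ segment ℝ (p : ℂ) q) :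
    r = p ∨ r = q :=
  (eq_or_eq_of_orientedArea_eq_zero (Circle.norm_coe p) (Circle.norm_coe q) (Circle.norm_coe r)
    (fun h => hpq (Circle.ext h)) (orientedArea_eq_zero_of_mem_segment h)).imp Circle.ext Circle.ext

section ChordEmbedding

variable {V : Type*} {G : SimpleGraph V} {f : V → Circle}

/-- The straight-line drawing of a graph whose vertices are placed on the circle without links. The
arc of an edge is written as the convex hull of its ends, which does not refer to their order. -/
def chordEmbedding (hf : Function.Injective f)
    (h : ∀ a b c d : V, G.Adj a b → G.Adj c d → Disjoint ({a, b} : Set V) {c, d} →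
      ¬ NonSplittableLink (f a) (f b) (f c) (f d)) : PlaneEmbedding G where
  point v := f v
  arc e := convexHull ℝ ((fun v => (f v : ℂ)) '' {v | v ∈ (e : Sym2 V)})
  point_injective u v huv := hf (Circle.ext huv)
  isPlaneArc a b hab := by
    refine ⟨Path.segment _ _, ?_, ?_⟩
    · intro s t hst
      have := AffineMap.lineMap_injective ℝ (fun h => hab.ne (hf (Circle.ext h))) hst
      exact Subtype.ext this
    · have hpair : {v | v ∈ s(a, b)} = ({a, b} : Set V) := by ext v; simp
      simp only [Path.range_segment, hpair, Set.image_pair, convexHull_pair]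
  mem_of_point_mem_arc := by
    rintro ⟨e, he⟩ v hv
    induction e with
    | _ a b =>
      have hpair : {v | v ∈ s(a, b)} = ({a, b} : Set V) := by ext v; simp
      simp only [hpair, Set.image_pair, convexHull_pair] at hv
      exact Sym2.mem_iff.2 ((eq_or_eq_of_mem_segment (hf.ne he.ne) hv).imp (@hf _ _) (@hf _ _))
  arc_inter_arc := by
    rintro ⟨e, he⟩ ⟨e', he'⟩ hne z ⟨hz, hz'⟩
    induction e with
    | _ a b =>
    induction e' with
    | _ c d =>
      have hpair : ∀ a b : V, {v | v ∈ s(a, b)} = ({a, b} : Set V) := fun a b => by ext v; simp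
      simp only [hpair, Set.image_pair, convexHull_pair] at hz hz'
      have hne' : s(a, b) ≠ s(c, d) := fun h => hne (Subtype.ext h)
      by_cases hdisj : Disjoint ({a, b} : Set V) {c, d}
      · exfalso
        refine Set.disjoint_left.1 (disjoint_segment_of_not_nonSplittableLink ?_
          (h a b c d he he' hdisj)) hz hz'
        have hab : a ≠ b := he.ne
        have hcd : c ≠ d := he'.ne
        simp only [Set.disjoint_insert_left, Set.disjoint_singleton_left, Set.mem_insert_iff,
          Set.mem_singleton_iff, not_or] at hdisj
        simp [hf.eq_iff, hab, hcd, hdisj]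
      · -- Up to the order of the ends, the edges have their first end in common.
        have key : ∀ a b d, G.Adj a b → G.Adj a d → b ≠ d → z ∈ segment ℝ (f a : ℂ) (f b) →
            z ∈ segment ℝ (f a : ℂ) (f d) → z = f a := fun a b d hab had hbd h1 h2 =>
          eq_of_mem_segment_of_mem_segment (hf.ne hab.ne) (hf.ne had.ne) (hf.ne hbd) h1 h2
        have hz2 := segment_symm ℝ (f a : ℂ) (f b) ▸ hz
        have hz2' := segment_symm ℝ (f c : ℂ) (f d) ▸ hz'
        rw [Set.not_disjoint_iff] at hdisj
        obtain ⟨v, hv, hv'⟩ := hdisj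
        rcases hv with rfl | rfl <;> rcases hv' with rfl | rfl
        · exact ⟨v, ⟨by simp, by simp⟩,
            (key v b d he he' (fun h => hne' (by rw [h])) hz hz').symm⟩
        · exact ⟨v, ⟨by simp, by simp⟩,
            (key v b c he he'.symm (fun h => hne' (by rw [h, Sym2.eq_swap])) hz hz2').symm⟩
        · exact ⟨v, ⟨by simp, by simp⟩,
            (key v a d he.symm he' (fun h => hne' (by rw [h, Sym2.eq_swap])) hz2 hz').symm⟩
        · exact ⟨v, ⟨by simp, by simp⟩,
            (key v a c he.symm he'.symm (fun h => hne' (by rw [h])) hz2 hz2').symm⟩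

/-- A chord drawing stays in the closed unit disc, so that every point of the circle touches the
outer face. -/
theorem isOuterplanar_of_forall_not_nonSplittableLink (hf : Function.Injective f)
    (h : ∀ a b c d : V, G.Adj a b → G.Adj c d → Disjoint ({a, b} : Set V) {c, d} →
      ¬ NonSplittableLink (f a) (f b) (f c) (f d)) : IsOuterplanar G := by
  refine ⟨chordEmbedding hf h, fun v => ?_⟩
  set D := chordEmbedding hf h with hD
  have hsupp : ∀ z ∈ D.support, ‖z‖ ≤ 1 := by
    rintro z (⟨u, rfl⟩ | hz)
    · exact (Circle.norm_coe (f u)).le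
    · obtain ⟨e, he⟩ := Set.mem_iUnion.1 hz
      have hsub : convexHull ℝ ((fun v => (f v : ℂ)) '' {v | v ∈ (e : Sym2 V)}) ⊆
          Metric.closedBall 0 1 := by
        refine convexHull_min ?_ (convex_closedBall _ _)
        rintro _ ⟨u, -, rfl⟩
        exact mem_closedBall_zero_iff.2 (Circle.norm_coe (f u)).le
      simpa using hsub he
  have hsub : {z : ℂ | 1 < ‖z‖} ⊆ D.outerFace := by
    intro z hz
    have hz1 : 1 < ‖z‖ := hz
    refine ⟨fun hmem => (hsupp z hmem).not_gt hz1, fun hb => ?_⟩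
    obtain ⟨C, hC⟩ := (hb.subset
      (D.lt_norm_subset_connectedComponentIn zero_le_one hsupp hz1)).exists_norm_le
    have h2 : ‖((|C| + 2 : ℝ) : ℂ)‖ = |C| + 2 := by
      rw [Complex.norm_real, Real.norm_of_nonneg (by positivity)]
    have := hC ((|C| + 2 : ℝ) : ℂ) (by
      rw [Set.mem_ofPred_eq, h2]; linarith [abs_nonneg C])
    rw [h2] at this
    linarith [le_abs_self C]
  refine ⟨closure_mono hsub ?_, fun hint => (interior_subset hint).1 (Or.inl ⟨v, rfl⟩)⟩
  have hset : {z : ℂ | 1 < ‖z‖} = (Metric.closedBall 0 1)ᶜ := by ext z; simp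
  rw [hset, closure_compl, interior_closedBall _ one_ne_zero]
  exact fun hmem => (mem_ball_zero_iff.1 hmem).ne (Circle.norm_coe (f v))

end ChordEmbedding

theorem mainTheorem1 {V : Type*} [Finite V] (G : SimpleGraph V) :
    IsIntrinsicallyCircleLinked G ↔ ¬ IsOuterplanar G := by
  constructor
  · intro hlink hout
    have := Fintype.ofFinite V
    obtain ⟨l, -, hl, hn⟩ := SimpleGraph.exists_nonCrossing hout.thetaFree hout.tetraFree Finset.univ
    exact hn.not_isIntrinsicallyCircleLinked (fun v => (hl v).2 (Finset.mem_univ v)) hlink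
  · intro hout f hf
    by_contra! hcon
    exact hout (isOuterplanar_of_forall_not_nonSplittableLink hf hcon)
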